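/- Let $\widehat{\mathbb C}$ be the Riemann sphere and let $\Gamma=\sum_{t=1}^{M}\Gamma_t$ ($M\ge 1$) be a holomorphic correspondence on $\widehat{\mathbb C}$: each $\Gamma_t\subseteq\widehat{\mathbb C}\times\widehat{\mathbb C}$ is an irreducible complex-analytic subvariety (repetitions are allowed), both coordinate projections map $\Gamma_t$ onto $\widehat{\mathbb C}$, and for every $x_0$ outside a finite set the fibres $\{x:(x,x_0)\in\Gamma_t\}$ and $\{y:(x_0,y)\in\Gamma_t\}$ are finite. Let $$\mathscr P^\Gamma(\widehat{\mathbb C})=\{(x_0,x_1,x_2,\dots;\alpha_1,\alpha_2,\dots): x_r\in\widehat{\mathbb C},\ \alpha_r\in\{1,\dots,M\},\ (x_{r-1},x_r)\in\Gamma_{\alpha_r}\text{ for all } r\ge 1\}$$ with the topology induced by the product topology and its Borel $\sigma$-algebra, let $\Pi_r$ ($r\ge 0$) and $\mathrm{Proj}_r$ ($r\ge 1$) send such a path to $x_r$ and to $\alpha_r$ respectively, and let $\sigma^\Gamma(x_0,x_1,\dots;\alpha_1,\alpha_2,\dots)=(x_1,x_2,\dots;\alpha_2,\alpha_3,\dots)$.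 For a probability measure $\mu$ and a finite collection $\mathcal A=\{A_1,\dots,A_k\}$ of sets that are $\mu$-measurable (measurable with respect to the completion of $\mu$) put $H_\mu(\mathcal A)=-\sum_i\mu(A_i)\log\mu(A_i)$, with $0\log 0=0$; the join $\bigvee_{p=0}^{n-1}\mathcal A_p$ is the collection of all intersections $\bigcap_{p=0}^{n-1}A_p$ with $A_p\in\mathcal A_p$. Let $\mu$ be a $\sigma^\Gamma$-invariant Borel probability measure on $\mathscr P^\Gamma(\widehat{\mathbb C})$ and let $\nu=(\Pi_0)_*\mu$. Then, for every finite $\nu$-measurable partition $\mathcal Q=\{Q_1,\dots,Q_s\}$ of $\widehat{\mathbb C}$ and every finite $\mu$-measurable partition $\mathcal P$ of $\mathscr P^\Gamma(\widehat{\mathbb C})$, the limits $$H_{(\nu,\mu)}(\mathcal Q;\Gamma)=\lim_{n\to\infty}\frac1n H_\mu\Big(\bigvee_{p=0}^{n-1}\big\{\Pi_p^{-1}(Q_i)\cap\mathrm{Proj}_{p+1}^{-1}(\{t\}):1\le i\le s,\ 1\le t\le M\big\}\Big),\qquad h_\mu(\sigma^\Gamma,\mathcal P)=\lim_{n\to\infty}\frac1n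 H_\mu\Big(\bigvee_{p=0}^{n-1}(\sigma^\Gamma)^{-p}(\mathcal P)\Big)$$ exist, and the intermediate entropy $h_{(\nu,\mu)}(\Gamma):=\sup_{\mathcal Q}H_{(\nu,\mu)}(\mathcal Q;\Gamma)$ equals the Kolmogorov–Sinai entropy $h_\mu(\sigma^\Gamma):=\sup_{\mathcal P}h_\mu(\sigma^\Gamma,\mathcal P)$: $$h_{(\nu,\mu)}(\Gamma)=h_\mu(\sigma^\Gamma).$$ The suprema are taken over all such finite partitions $\mathcal Q$ and $\mathcal P$. -/

import Mathlib

open Set Filter Topology MeasureTheory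

noncomputable section

/-! ## The Riemann sphere -/

/-- The Riemann sphere, as the one-point compactification of the complex plane. -/
abbrev RiemannSphere : Type := OnePoint ℂ

namespace RiemannSphere

/-- The Borel sigma-algebra of the Riemann sphere. -/
instance instMeasurableSpace : MeasurableSpace RiemannSphere := borel RiemannSphere

instance instBorelSpace : BorelSpace RiemannSphere := ⟨rfl⟩

instance instSecondCountableTopology : SecondCountableTopology RiemannSphere := by
  have : Fact (Module.finrank ℝ (EuclideanSpace ℝ (Fin 3)) = 2 + 1) := ⟨by simp⟩
  have e := onePointEquivSphereOfFinrankEq (ι := Fin 3) (V := ℂ)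
    (by simp [Complex.finrank_real_complex])
  exact e.secondCountableTopology

/-- The two standard holomorphic parametrisations of the Riemann sphere by the complex plane:
`z ↦ z` (for `false`), whose image is the complement of `∞`, and `w ↦ 1 / w`, `0 ↦ ∞`
(for `true`), whose image is the complement of `0`. -/
def param : Bool → ℂ → RiemannSphere
  | false => fun z => (z : OnePoint ℂ)
  | true => fun w => if w = 0 then OnePoint.infty else ((w⁻¹ : ℂ) : OnePoint ℂ)

end RiemannSphere

/-! ## Complex-analytic subvarieties of the product of two Riemann spheres -/

/-- A complex-analytic subset of `ℂ × ℂ`: near every point of `ℂ × ℂ` it is the common zero set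
of finitely many holomorphic functions. -/
def IsAnalyticSubsetC2 (S : Set (ℂ × ℂ)) : Prop :=
  ∀ p : ℂ × ℂ, ∃ U : Set (ℂ × ℂ), IsOpen U ∧ p ∈ U ∧
    ∃ (k : ℕ) (f : Fin k → ℂ × ℂ → ℂ), (∀ i, DifferentiableOn ℂ (f i) U) ∧
      S ∩ U = {q ∈ U | ∀ i, f i q = 0}

/-- A complex-analytic subset (subvariety) of the product of two Riemann spheres, expressed in the
four product charts, whose images are open and cover the product. -/
def IsAnalyticSubvariety (Z : Set (RiemannSphere × RiemannSphere)) : Prop :=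
  ∀ a b : Bool, IsAnalyticSubsetC2 (Prod.map (RiemannSphere.param a) (RiemannSphere.param b) ⁻¹' Z)

/-- An irreducible complex-analytic subvariety: nonempty, and not the union of two proper
complex-analytic subvarieties. -/
def IsIrreducibleSubvariety (Z : Set (RiemannSphere × RiemannSphere)) : Prop :=
  IsAnalyticSubvariety Z ∧ Z.Nonempty ∧
    ∀ A B : Set (RiemannSphere × RiemannSphere), IsAnalyticSubvariety A → IsAnalyticSubvariety B →
      Z = A ∪ B → A = Z ∨ B = Z

/-! ## Holomorphic correspondences -/

/-- A holomorphic correspondence `Γ = Γ_1 + ⋯ + Γ_M` on the Riemann sphere. The components are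
listed as a family, so that they may be repeated according to multiplicity. "Generic" means: away
from finitely many points, that is, on a nonempty Zariski open subset of the sphere. -/
structure HolomorphicCorrespondence where
  /-- the number of components -/
  M : ℕ
  M_pos : 0 < M
  /-- the components -/
  component : Fin M → Set (RiemannSphere × RiemannSphere)
  irreducible : ∀ t, IsIrreducibleSubvariety (component t)
  surj_fst : ∀ t, Prod.fst '' component t = univ
  surj_snd : ∀ t, Prod.snd '' component t = univ
  generic_finite : ∀ t, ∃ E : Set RiemannSphere, E.Finite ∧ ∀ x₀ ∉ E,
    (Prod.fst '' (Prod.snd ⁻¹' {x₀} ∩ component t)).Finite ∧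
    (Prod.snd '' (Prod.fst ⁻¹' {x₀} ∩ component t)).Finite

/-! ## Entropy of finite partitions -/

/-- A finite `μ`-measurable partition `A_1, …, A_s` of `X`. Empty members are allowed; they do not
contribute to entropies. Sets are measurable with respect to the completion of `μ`. -/
structure IsFinitePartition {X : Type*} [MeasurableSpace X] (μ : Measure X) {s : ℕ}
    (A : Fin s → Set X) : Prop where
  nullMeasurable : ∀ i, NullMeasurableSet (A i) μ
  disjoint : Pairwise (fun i j => Disjoint (A i) (A j))
  cover : ⋃ i, A i = univ

/-- `H_μ(A) = - ∑ μ(A_i) log μ(A_i)`, with `0 log 0 = 0`. -/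
def partitionEntropy {X : Type*} [MeasurableSpace X] (μ : Measure X) {ι : Type*} [Fintype ι]
    (A : ι → Set X) : ℝ :=
  -∑ i, μ.real (A i) * Real.log (μ.real (A i))

/-- The join `A_0 ∨ A_1 ∨ ⋯ ∨ A_{n-1}` of the first `n` members of a sequence of collections of
sets, all indexed by `κ`: all intersections `⋂_{p < n} A_p(w_p)`. -/
def iteratedJoin {X κ : Type*} (A : ℕ → κ → Set X) (n : ℕ) : (Fin n → κ) → Set X :=
  fun w => ⋂ p : Fin n, A p (w p)

/-- `(1 / n) H_μ(A_0 ∨ ⋯ ∨ A_{n-1})`. -/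
def meanEntropy {X : Type*} [MeasurableSpace X] (μ : Measure X) {κ : Type*} [Fintype κ]
    (A : ℕ → κ → Set X) (n : ℕ) : ℝ :=
  (1 / (n : ℝ)) * partitionEntropy μ (iteratedJoin A n)

/-- The entropy rate of a sequence of collections, that is, the limit of `meanEntropy μ A n` as
`n → ∞` (written as an upper limit so that it makes sense before the limit is known to exist). -/
def entropyRate {X : Type*} [MeasurableSpace X] (μ : Measure X) {κ : Type*} [Fintype κ]
    (A : ℕ → κ → Set X) : EReal :=
  limsup (fun n : ℕ => ((meanEntropy μ A n : ℝ) : EReal)) atTop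

/-- The sequence of collections `T^{-p}(P) = {T^{-p}(P_1), …, T^{-p}(P_s)}`. -/
def pullbackSeq {X : Type*} (T : X → X) {s : ℕ} (P : Fin s → Set X) : ℕ → Fin s → Set X :=
  fun p i => (T^[p]) ⁻¹' (P i)

/-- The Kolmogorov–Sinai (measure-theoretic) entropy `h_μ(T)`. -/
def ksEntropy {X : Type*} [MeasurableSpace X] (μ : Measure X) (T : X → X) : EReal :=
  ⨆ (s : ℕ) (P : Fin s → Set X) (_ : IsFinitePartition μ P), entropyRate μ (pullbackSeq T P)

namespace HolomorphicCorrespondence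

variable (Γ : HolomorphicCorrespondence)

/-! ## The space of infinite permissible paths -/

/-- The infinite permissible paths `(x_0, x_1, x_2, …; α_1, α_2, …)`, `(x_{r-1}, x_r) ∈ Γ_{α_r}`.
The second sequence is indexed from `0`: its entry at `r` is `α_{r+1}`. -/
def paths : Set ((ℕ → RiemannSphere) × (ℕ → Fin Γ.M)) :=
  {u | ∀ r : ℕ, (u.1 r, u.1 (r + 1)) ∈ Γ.component (u.2 r)}

/-- The path space, with the topology (and sigma-algebra) of a subspace of the countable product of
spheres and finite discrete spaces. This is the topology of the metric
`max (sup_r 2^{-r} d(x_r, y_r), sup_r 2^{-r} (1 - δ(α_r, β_r)))`. -/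
abbrev PathSpace : Type := Γ.paths

/-- The sigma-algebra of the path space is its Borel sigma-algebra. -/
instance instBorelSpacePathSpace : BorelSpace Γ.PathSpace :=
  Subtype.borelSpace Γ.paths

/-- `Π_r`, the `r`-th point of a path, `r ≥ 0`. -/
def pointProj (r : ℕ) (u : Γ.PathSpace) : RiemannSphere := u.1.1 r

/-- `Proj_{p+1}`, the label `α_{p+1}` of the `(p+1)`-st step of a path, `p ≥ 0`. -/
def labelProjSucc (p : ℕ) (u : Γ.PathSpace) : Fin Γ.M := u.1.2 p

/-- The left shift `(x_0, x_1, …; α_1, α_2, …) ↦ (x_1, x_2, …; α_2, α_3, …)`. -/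
def shift (u : Γ.PathSpace) : Γ.PathSpace :=
  ⟨(fun r => u.1.1 (r + 1), fun r => u.1.2 (r + 1)), fun r => u.2 (r + 1)⟩

/-! ## The intermediate entropy -/

/-- The collections `{Π_p⁻¹(Q_i) ∩ Proj_{p+1}⁻¹({t}) : 1 ≤ i ≤ s, 1 ≤ t ≤ M}`, `p ≥ 0`, associated
with a partition `Q` of the sphere. -/
def liftedSeq {s : ℕ} (Q : Fin s → Set RiemannSphere) : ℕ → Fin s × Fin Γ.M → Set Γ.PathSpace :=
  fun p it => Γ.pointProj p ⁻¹' (Q it.1) ∩ Γ.labelProjSucc p ⁻¹' {it.2}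

/-- The intermediate entropy `h_(ν,μ)(Γ)`: the supremum, over all finite `ν`-measurable partitions
`Q` of the sphere, of the entropy rate with respect to `μ` of the lifted collections. -/
def intermediateEntropy (ν : Measure RiemannSphere) (μ : Measure Γ.PathSpace) : EReal :=
  ⨆ (s : ℕ) (Q : Fin s → Set RiemannSphere) (_ : IsFinitePartition ν Q),
    entropyRate μ (Γ.liftedSeq Q)

end HolomorphicCorrespondence

end

open Set Filter Topology MeasureTheory

/-! A finite partition is treated as a finite-valued map `X`, and its refinements under `T` as
itineraries `X^n = (X, X ∘ T, …, X ∘ T^(n-1))`. A partition `Q` of the sphere, coded by `q`, gives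
the map `u ↦ (q(x_0), α_1)` on paths, and the lifted collections are the pullbacks of its fibres
under the powers of the shift (`liftedSeq_eq`). Hence the intermediate entropy is a supremum of
shift entropies over special partitions, which gives `≤`; both limits exist by Fekete's lemma.

For `≥`, let `Y_N` record the position of `x_0` relative to the first `N` sets of a countable
generating family, together with `α_1`. The itineraries `Y_N^N` determine an algebra of sets
generating the Borel sigma-algebra of the path space, so any finite partition `X` satisfies `H(X |
Y_N^N) < ε` for some `N` (`exists_mapEntropy_prodMk_sub_lt`). The classical estimate `h(X) ≤ h(Y_N)
+ H(X | Y_N^N)` (`le_of_tendsto_mapEntropy_itinerary`), a consequence of strong subadditivity, then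
bounds `h(X)` by the intermediate entropy plus `ε`. Conditional entropies appear throughout as
differences `H(X, Z) - H(Z)`. -/

/-! ## Entropy of finite-valued maps -/

/-- The fibres of a map with finitely many values are measurable for the completed measure. -/
def FibresNullMeasurable {Ω κ : Type*} [MeasurableSpace Ω] (μ : Measure Ω) (X : Ω → κ) : Prop :=
  ∀ k, NullMeasurableSet (X ⁻¹' {k}) μ

/-- The entropy of the partition into the fibres of a finite-valued map. -/
noncomputable def mapEntropy {Ω κ : Type*} [MeasurableSpace Ω] [Fintype κ] (μ : Measure Ω)
    (X : Ω → κ) : ℝ :=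
  partitionEntropy μ fun k => X ⁻¹' {k}

section MapEntropy

variable {Ω : Type*} [MeasurableSpace Ω] {μ : Measure Ω}
  {κ κ' κ'' : Type*}

/-- The itinerary `(X, X ∘ T, …, X ∘ T^(n-1))`. -/
def itinerary (T : Ω → Ω) (X : Ω → κ) (n : ℕ) : Ω → Fin n → κ := fun ω p => X (T^[p] ω)

namespace FibresNullMeasurable

lemma preimage [Finite κ] {X : Ω → κ} (hX : FibresNullMeasurable μ X) (B : Set κ) :
    NullMeasurableSet (X ⁻¹' B) μ := by
  rw [← biUnion_preimage_singleton]
  exact NullMeasurableSet.biUnion B.to_countable fun k _ => hX k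

lemma comp [Finite κ] {X : Ω → κ} (hX : FibresNullMeasurable μ X) (φ : κ → κ') :
    FibresNullMeasurable μ (φ ∘ X) := fun k => by
  rw [preimage_comp]
  exact hX.preimage _

lemma prodMk {X : Ω → κ} {Y : Ω → κ'} (hX : FibresNullMeasurable μ X)
    (hY : FibresNullMeasurable μ Y) : FibresNullMeasurable μ fun ω => (X ω, Y ω) := fun k => by
  have : (fun ω => (X ω, Y ω)) ⁻¹' {k} = X ⁻¹' {k.1} ∩ Y ⁻¹' {k.2} := by
    ext ω; simp [Prod.ext_iff]
  rw [this]
  exact (hX _).inter (hY _)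

lemma pi {n : ℕ} {X : ℕ → Ω → κ} (hX : ∀ p, FibresNullMeasurable μ (X p)) :
    FibresNullMeasurable μ fun ω (p : Fin n) => X p ω := fun w => by
  have : (fun ω (p : Fin n) => X p ω) ⁻¹' {w} = ⋂ p : Fin n, X p ⁻¹' {w p} := by
    ext ω; simp [funext_iff]
  rw [this]
  exact NullMeasurableSet.iInter fun p => hX p _

lemma comp_measurePreserving {T : Ω → Ω} (hT : MeasurePreserving T μ μ)
    {X : Ω → κ} (hX : FibresNullMeasurable μ X) : FibresNullMeasurable μ (X ∘ T) := fun k =>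
  (hX k).preimage hT.quasiMeasurePreserving

lemma itinerary {T : Ω → Ω} (hT : MeasurePreserving T μ μ)
    {X : Ω → κ} (hX : FibresNullMeasurable μ X) (n : ℕ) :
    FibresNullMeasurable μ (_root_.itinerary T X n) :=
  FibresNullMeasurable.pi fun p => hX.comp_measurePreserving (hT.iterate p)

end FibresNullMeasurable

variable [Fintype κ]

lemma mapEntropy_eq_sum_negMulLog (X : Ω → κ) :
    mapEntropy μ X = ∑ k, Real.negMulLog (μ.real (X ⁻¹' {k})) := by
  simp [mapEntropy, partitionEntropy, Real.negMulLog]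

lemma mapEntropy_nonneg [IsProbabilityMeasure μ] (X : Ω → κ) : 0 ≤ mapEntropy μ X := by
  rw [mapEntropy_eq_sum_negMulLog]
  exact Finset.sum_nonneg fun k _ => Real.negMulLog_nonneg measureReal_nonneg measureReal_le_one

lemma sum_measureReal_prodMk_left [IsFiniteMeasure μ] {X : Ω → κ} {Y : Ω → κ'}
    (hX : FibresNullMeasurable μ X) (hY : FibresNullMeasurable μ Y) (y : κ') :
    ∑ x, μ.real ((fun ω => (X ω, Y ω)) ⁻¹' {(x, y)}) = μ.real (Y ⁻¹' {y}) := by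
  classical
  have hU : Y ⁻¹' {y} = ⋃ x ∈ (Finset.univ : Finset κ), (fun ω => (X ω, Y ω)) ⁻¹' {(x, y)} := by
    ext ω; simp
  rw [hU, measureReal_biUnion_finset₀]
  · intro a _ b _ hab
    refine Disjoint.aedisjoint (disjoint_left.2 fun ω ha hb => hab ?_)
    simp only [mem_preimage, mem_singleton_iff, Prod.mk.injEq] at ha hb
    exact ha.1.symm.trans hb.1
  · exact fun x _ => hX.prodMk hY _

variable [Fintype κ'] [Fintype κ'']

lemma mapEntropy_comp_equiv (X : Ω → κ) (e : κ ≃ κ') : mapEntropy μ (e ∘ X) = mapEntropy μ X := by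
  rw [mapEntropy_eq_sum_negMulLog, mapEntropy_eq_sum_negMulLog]
  refine (Fintype.sum_equiv e _ _ fun k => ?_).symm
  congr 2
  ext ω; simp

/-- `H(Y) ≤ H(X, Y)`. -/
lemma mapEntropy_le_prodMk [IsProbabilityMeasure μ] {X : Ω → κ} {Y : Ω → κ'}
    (hX : FibresNullMeasurable μ X) (hY : FibresNullMeasurable μ Y) :
    mapEntropy μ Y ≤ mapEntropy μ fun ω => (X ω, Y ω) := by
  simp only [mapEntropy_eq_sum_negMulLog, Fintype.sum_prod_type_right]
  refine Finset.sum_le_sum fun y _ => ?_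
  have h := sum_measureReal_prodMk_left hX hY y
  rw [Real.negMulLog]
  -- Only the factor outside the logarithm is expanded over `x`; the logarithms are then compared
  -- term by term.
  nth_rw 1 [← h]
  rw [← Finset.sum_neg_distrib, Finset.sum_mul]
  refine Finset.sum_le_sum fun x _ => ?_
  rw [Real.negMulLog]
  have hxy : 0 ≤ μ.real ((fun ω => (X ω, Y ω)) ⁻¹' {(x, y)}) := measureReal_nonneg
  rcases hxy.eq_or_lt with h0 | h0
  · simp [← h0]
  · refine mul_le_mul_of_nonpos_left (Real.log_le_log h0 ?_) (by linarith)
    refine measureReal_mono fun ω hω => ?_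
    simp only [mem_preimage, mem_singleton_iff, Prod.mk.injEq] at hω ⊢
    exact hω.2

lemma mapEntropy_prodMk_comp (X : Ω → κ) (φ : κ → κ') :
    mapEntropy μ (fun ω => (X ω, φ (X ω))) = mapEntropy μ X := by
  classical
  simp only [mapEntropy_eq_sum_negMulLog, Fintype.sum_prod_type]
  refine Finset.sum_congr rfl fun x _ => ?_
  rw [Finset.sum_eq_single (φ x)]
  · congr 2
    ext ω
    simp only [mem_preimage, mem_singleton_iff, Prod.mk.injEq]
    exact ⟨fun h => h.1, fun h => ⟨h, by rw [h]⟩⟩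
  · intro y _ hy
    have : (fun ω => (X ω, φ (X ω))) ⁻¹' {(x, y)} = ∅ := by
      ext ω
      simp only [mem_preimage, mem_singleton_iff, Prod.mk.injEq, mem_empty_iff_false, iff_false]
      rintro ⟨rfl, rfl⟩
      exact hy rfl
    simp [this]
  · simp

lemma mapEntropy_comp_le [IsProbabilityMeasure μ] {X : Ω → κ} (hX : FibresNullMeasurable μ X)
    (φ : κ → κ') : mapEntropy μ (φ ∘ X) ≤ mapEntropy μ X :=
  (mapEntropy_le_prodMk hX (hX.comp φ)).trans_eq (mapEntropy_prodMk_comp X φ)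

/-- A finite-valued map that factors through another one has smaller entropy. -/
lemma mapEntropy_le_of_factor [IsProbabilityMeasure μ] {X : Ω → κ} (hX : FibresNullMeasurable μ X)
    {Y : Ω → κ'} (φ : κ → κ') (h : ∀ ω, Y ω = φ (X ω)) : mapEntropy μ Y ≤ mapEntropy μ X := by
  obtain rfl : Y = φ ∘ X := funext h
  exact mapEntropy_comp_le hX φ

/-- The tangent bound `log t ≤ t - 1` at `t = q / p`, multiplied by `p`: the pointwise form of
Gibbs' inequality. -/
lemma sub_le_mul_log_sub_log {p q : ℝ} (hp : 0 ≤ p) (hq : 0 ≤ q) (h : p ≠ 0 → q ≠ 0) :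
    p - q ≤ p * (Real.log p - Real.log q) := by
  rcases hp.eq_or_lt with rfl | hp
  · simpa using hq
  · have hq' : 0 < q := hq.lt_of_ne' (h hp.ne')
    have h1 := Real.log_le_sub_one_of_pos (div_pos hq' hp)
    rw [Real.log_div hq'.ne' hp.ne'] at h1
    have h2 := mul_le_mul_of_nonneg_left h1 hp.le
    have h3 : p * (q / p - 1) = q - p := by field_simp
    linarith

/-- Strong subadditivity: `H(X, Y, Z) + H(Z) ≤ H(X, Z) + H(Y, Z)`. -/
lemma mapEntropy_submodular [IsProbabilityMeasure μ] {X : Ω → κ} {Y : Ω → κ'} {Z : Ω → κ''}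
    (hX : FibresNullMeasurable μ X) (hY : FibresNullMeasurable μ Y)
    (hZ : FibresNullMeasurable μ Z) :
    mapEntropy μ (fun ω => (X ω, Y ω, Z ω)) + mapEntropy μ Z ≤
      mapEntropy μ (fun ω => (X ω, Z ω)) + mapEntropy μ (fun ω => (Y ω, Z ω)) := by
  set P : κ → κ' → κ'' → ℝ := fun x y z => μ.real ((fun ω => (X ω, Y ω, Z ω)) ⁻¹' {(x, y, z)})
    with hP
  set A : κ → κ'' → ℝ := fun x z => μ.real ((fun ω => (X ω, Z ω)) ⁻¹' {(x, z)}) with hA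
  set B : κ' → κ'' → ℝ := fun y z => μ.real ((fun ω => (Y ω, Z ω)) ⁻¹' {(y, z)}) with hB
  set C : κ'' → ℝ := fun z => μ.real (Z ⁻¹' {z}) with hC
  have hPB : ∀ y z, ∑ x, P x y z = B y z := fun y z =>
    sum_measureReal_prodMk_left hX (hY.prodMk hZ) (y, z)
  have hPA : ∀ x z, ∑ y, P x y z = A x z := fun x z => by
    refine Eq.trans ?_ (sum_measureReal_prodMk_left hY (hX.prodMk hZ) (x, z))
    refine Finset.sum_congr rfl fun y _ => ?_
    refine congrArg μ.real ?_
    ext ω; simp only [mem_preimage, mem_singleton_iff, Prod.mk.injEq]; tauto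
  have hAC : ∀ z, ∑ x, A x z = C z := sum_measureReal_prodMk_left hX hZ
  have hBC : ∀ z, ∑ y, B y z = C z := sum_measureReal_prodMk_left hY hZ
  have hP0 : ∀ x y z, 0 ≤ P x y z := fun _ _ _ => measureReal_nonneg
  have hA0 : ∀ x z, 0 ≤ A x z := fun _ _ => measureReal_nonneg
  have hB0 : ∀ y z, 0 ≤ B y z := fun _ _ => measureReal_nonneg
  have hC0 : ∀ z, 0 ≤ C z := fun _ => measureReal_nonneg
  have hPA' : ∀ x y z, P x y z ≤ A x z := fun x y z => by
    rw [← hPA]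
    exact Finset.single_le_sum (f := fun y => P x y z) (fun _ _ => hP0 _ _ _) (Finset.mem_univ y)
  have hPB' : ∀ x y z, P x y z ≤ B y z := fun x y z => by
    rw [← hPB]
    exact Finset.single_le_sum (f := fun x => P x y z) (fun _ _ => hP0 _ _ _) (Finset.mem_univ x)
  have hAC' : ∀ x z, A x z ≤ C z := fun x z => by
    rw [← hAC]
    exact Finset.single_le_sum (f := fun x => A x z) (fun _ _ => hA0 _ _) (Finset.mem_univ x)
  -- All four entropies become sums over the same triples `(x, y, z)` with weight `P x y z`, so that
  -- they can be combined under one sum.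
  have e1 : mapEntropy μ (fun ω => (X ω, Y ω, Z ω)) =
      -∑ z, ∑ y, ∑ x, P x y z * Real.log (P x y z) := by
    simp only [mapEntropy, partitionEntropy, Fintype.sum_prod_type_right]; rfl
  have e2 : mapEntropy μ (fun ω => (X ω, Z ω)) =
      -∑ z, ∑ y, ∑ x, P x y z * Real.log (A x z) := by
    simp only [mapEntropy, partitionEntropy, Fintype.sum_prod_type_right]
    congr 1
    refine Finset.sum_congr rfl fun z _ => ?_
    rw [Finset.sum_comm]
    refine Finset.sum_congr rfl fun x _ => ?_
    rw [← Finset.sum_mul, hPA]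
  have e3 : mapEntropy μ (fun ω => (Y ω, Z ω)) =
      -∑ z, ∑ y, ∑ x, P x y z * Real.log (B y z) := by
    simp only [mapEntropy, partitionEntropy, Fintype.sum_prod_type_right]
    congr 1
    refine Finset.sum_congr rfl fun z _ => Finset.sum_congr rfl fun y _ => ?_
    rw [← Finset.sum_mul, hPB]
  have e4 : mapEntropy μ Z = -∑ z, ∑ y, ∑ x, P x y z * Real.log (C z) := by
    simp only [mapEntropy, partitionEntropy]
    congr 1
    refine Finset.sum_congr rfl fun z _ => ?_
    simp only [← Finset.sum_mul, hPB, hBC]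
    rfl
  -- Gibbs' inequality at fixed `z`, comparing `P` with the weights `A * B / C` that make `X` and
  -- `Y` conditionally independent given `Z`. Both have total mass `C z`, also when `C z = 0`, since
  -- division by zero gives `0`.
  have key : ∀ z, 0 ≤ ∑ y, ∑ x, P x y z *
      (Real.log (P x y z) + Real.log (C z) - Real.log (A x z) - Real.log (B y z)) := by
    intro z
    have hsum : ∑ y, ∑ x, (P x y z - A x z * B y z / C z) = 0 := by
      simp only [Finset.sum_sub_distrib, hPB, hBC, ← Finset.sum_div, ← Finset.sum_mul, hAC,
        ← Finset.mul_sum]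
      rcases eq_or_ne (C z) 0 with h | h
      · simp [h]
      · field_simp; ring
    rw [← hsum]
    refine Finset.sum_le_sum fun y _ => Finset.sum_le_sum fun x _ => ?_
    rcases (hP0 x y z).eq_or_lt with h | h
    · rw [← h]
      have := div_nonneg (mul_nonneg (hA0 x z) (hB0 y z)) (hC0 z)
      linarith
    · have hA1 := h.trans_le (hPA' x y z)
      have hB1 := h.trans_le (hPB' x y z)
      have hC1 := hA1.trans_le (hAC' x z)
      have := sub_le_mul_log_sub_log h.le
        (div_nonneg (mul_nonneg (hA0 x z) (hB0 y z)) (hC0 z)) (fun _ => by positivity)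
      rw [Real.log_div (by positivity) hC1.ne', Real.log_mul hA1.ne' hB1.ne'] at this
      refine this.trans_eq ?_
      ring
  have := Finset.sum_nonneg fun z (_ : z ∈ Finset.univ) => key z
  rw [e1, e2, e3, e4]
  simp only [mul_sub, mul_add, Finset.sum_sub_distrib, Finset.sum_add_distrib] at this
  linarith

/-- Subadditivity: `H(X, Y) ≤ H(X) + H(Y)`. -/
lemma mapEntropy_prodMk_le_add [IsProbabilityMeasure μ] {X : Ω → κ} {Y : Ω → κ'}
    (hX : FibresNullMeasurable μ X) (hY : FibresNullMeasurable μ Y) :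
    mapEntropy μ (fun ω => (X ω, Y ω)) ≤ mapEntropy μ X + mapEntropy μ Y := by
  -- Conditioning on a constant map turns strong subadditivity into subadditivity.
  have hZ : FibresNullMeasurable μ fun _ : Ω => () := fun k => by simp
  have h := mapEntropy_submodular hX hY hZ
  have h1 := mapEntropy_le_of_factor (hX.prodMk (hY.prodMk hZ)) (Y := fun ω => (X ω, Y ω))
    (fun p => (p.1, p.2.1)) fun _ => rfl
  have h2 := mapEntropy_prodMk_comp (μ := μ) X fun _ => ()
  have h3 := mapEntropy_prodMk_comp (μ := μ) Y fun _ => ()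
  have h4 := mapEntropy_nonneg (μ := μ) fun _ : Ω => ()
  linarith

/-- Conditional entropy decreases when the conditioning map is refined. -/
lemma mapEntropy_prodMk_sub_le_of_factor [IsProbabilityMeasure μ] {X : Ω → κ} {Z : Ω → κ'}
    (hX : FibresNullMeasurable μ X) (hZ : FibresNullMeasurable μ Z) (φ : κ' → κ'') :
    mapEntropy μ (fun ω => (X ω, Z ω)) - mapEntropy μ Z ≤
      mapEntropy μ (fun ω => (X ω, φ (Z ω))) - mapEntropy μ (φ ∘ Z) := by
  have h := mapEntropy_submodular hX hZ (hZ.comp φ)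
  have h1 := mapEntropy_le_of_factor (hX.prodMk (hZ.prodMk (hZ.comp φ)))
    (Y := fun ω => (X ω, Z ω)) (fun p => (p.1, p.2.1)) fun _ => rfl
  have h2 := mapEntropy_prodMk_comp (μ := μ) Z φ
  simp only [Function.comp_def] at *
  linarith

/-! ### Itineraries under a measure-preserving map -/

lemma mapEntropy_comp_measurePreserving {T : Ω → Ω} (hT : MeasurePreserving T μ μ)
    {X : Ω → κ} (hX : FibresNullMeasurable μ X) : mapEntropy μ (X ∘ T) = mapEntropy μ X := by
  simp only [mapEntropy_eq_sum_negMulLog, preimage_comp, measureReal_def,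
    hT.measure_preimage (hX _)]

/-- The last `n` entries of an itinerary of length `m + n` form the `n`-itinerary composed with
`T^m`, which has the same entropy by invariance. -/
lemma subadditive_mapEntropy_itinerary [IsProbabilityMeasure μ] {T : Ω → Ω}
    (hT : MeasurePreserving T μ μ) {X : Ω → κ} (hX : FibresNullMeasurable μ X) :
    Subadditive fun n => mapEntropy μ (itinerary T X n) := fun m n => by
  have hm := hX.itinerary hT m
  have hn := hX.itinerary hT n
  have hn' := hn.comp_measurePreserving (hT.iterate m)
  calc mapEntropy μ (itinerary T X (m + n))
      ≤ mapEntropy μ fun ω => (itinerary T X m ω, (itinerary T X n ∘ T^[m]) ω) := by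
        refine mapEntropy_le_of_factor (hm.prodMk hn') (fun p => Fin.append p.1 p.2) fun ω => ?_
        ext i
        refine Fin.addCases (fun i => ?_) (fun i => ?_) i
        · simp [itinerary]
        · simp [itinerary, ← Function.iterate_add_apply, add_comm]
    _ ≤ _ := mapEntropy_prodMk_le_add hm hn'
    _ = _ := by rw [mapEntropy_comp_measurePreserving (hT.iterate m) hn]

/-- `H(X^n, Y^n) - H(Y^n) ≤ n (H(X, Y) - H(Y))`. -/
lemma mapEntropy_itinerary_prodMk_le [IsProbabilityMeasure μ] {T : Ω → Ω}
    (hT : MeasurePreserving T μ μ) {X : Ω → κ} (hX : FibresNullMeasurable μ X)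
    {Y : Ω → κ'} (hY : FibresNullMeasurable μ Y) (n : ℕ) :
    mapEntropy μ (fun ω => (itinerary T X n ω, itinerary T Y n ω)) ≤
      mapEntropy μ (itinerary T Y n) +
        n * (mapEntropy μ (fun ω => (X ω, Y ω)) - mapEntropy μ Y) := by
  induction n with
  | zero =>
    have := mapEntropy_le_of_factor (hY.itinerary hT 0)
      (Y := fun ω => (itinerary T X 0 ω, itinerary T Y 0 ω)) (fun y => (Fin.elim0, y))
      fun ω =>
        Prod.ext (Subsingleton.elim _ _) rfl
    simpa using this
  | succ n ih =>
    have hXn := hX.itinerary hT n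
    have hYn := hY.itinerary hT n
    have hYs := hY.itinerary hT (n + 1)
    have hx := hX.comp_measurePreserving (hT.iterate n)
    have hy := hY.comp_measurePreserving (hT.iterate n)
    -- `s1`: given the new entry of `Y`, the new entry of `X` costs at most `H(X, Y) - H(Y)`. `s2`:
    -- the new entry of `Y` adds no more to `(X^n, Y^n)` than to `Y^n` alone.
    have s1 := mapEntropy_submodular hx (hXn.prodMk hYn) hy
    have s2 := mapEntropy_submodular hXn hy hYn
    have c1 : mapEntropy μ (Y ∘ T^[n]) = mapEntropy μ Y :=
      mapEntropy_comp_measurePreserving (hT.iterate n) hY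
    have c2 : mapEntropy μ (fun ω => ((X ∘ T^[n]) ω, (Y ∘ T^[n]) ω)) =
        mapEntropy μ fun ω => (X ω, Y ω) :=
      mapEntropy_comp_measurePreserving (hT.iterate n) (hX.prodMk hY)
    have f1 : mapEntropy μ (fun ω => (itinerary T X (n + 1) ω, itinerary T Y (n + 1) ω)) ≤
        mapEntropy μ (fun ω => ((X ∘ T^[n]) ω, (itinerary T X n ω, itinerary T Y n ω),
          (Y ∘ T^[n]) ω)) := by
      refine mapEntropy_le_of_factor (hx.prodMk ((hXn.prodMk hYn).prodMk hy))
        (fun p => (Fin.snoc p.2.1.1 p.1, Fin.snoc p.2.1.2 p.2.2)) fun ω => ?_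
      ext i
      · refine Fin.lastCases ?_ (fun i => ?_) i <;> simp [itinerary]
      · refine Fin.lastCases ?_ (fun i => ?_) i <;> simp [itinerary]
    have f2 : mapEntropy μ (fun ω => ((itinerary T X n ω, itinerary T Y n ω), (Y ∘ T^[n]) ω)) ≤
        mapEntropy μ (fun ω => (itinerary T X n ω, (Y ∘ T^[n]) ω, itinerary T Y n ω)) :=
      mapEntropy_le_of_factor (hXn.prodMk (hy.prodMk hYn))
        (fun p => ((p.1, p.2.2), p.2.1)) fun ω => rfl
    have f3 : mapEntropy μ (fun ω => ((Y ∘ T^[n]) ω, itinerary T Y n ω)) ≤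
        mapEntropy μ (itinerary T Y (n + 1)) :=
      mapEntropy_le_of_factor hYs (fun p => (p (Fin.last n), fun i => p i.castSucc)) fun ω => rfl
    push_cast
    linarith

/-- `H(X^n) ≤ H(Y^(n+N)) + n (H(X, Y^N) - H(Y^N))`. -/
lemma mapEntropy_itinerary_le [IsProbabilityMeasure μ] {T : Ω → Ω}
    (hT : MeasurePreserving T μ μ) {X : Ω → κ} (hX : FibresNullMeasurable μ X)
    {Y : Ω → κ'} (hY : FibresNullMeasurable μ Y) (N n : ℕ) :
    mapEntropy μ (itinerary T X n) ≤ mapEntropy μ (itinerary T Y (n + N)) +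
      n * (mapEntropy μ (fun ω => (X ω, itinerary T Y N ω)) - mapEntropy μ (itinerary T Y N)) := by
  have hYN := hY.itinerary hT N
  have h1 := mapEntropy_itinerary_prodMk_le hT hX hYN n
  have h2 : mapEntropy μ (itinerary T X n) ≤
      mapEntropy μ (fun ω => (itinerary T X n ω, itinerary T (itinerary T Y N) n ω)) :=
    mapEntropy_le_of_factor ((hX.itinerary hT n).prodMk (hYN.itinerary hT n)) Prod.fst fun _ => rfl
  -- Overlapping `N`-blocks started at times below `n` only see times below `n + N`.
  have h3 : mapEntropy μ (itinerary T (itinerary T Y N) n) ≤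
      mapEntropy μ (itinerary T Y (n + N)) :=
    mapEntropy_le_of_factor (hY.itinerary hT (n + N))
      (fun w i j => w ⟨i + j, by omega⟩) fun ω => by
        ext i j
        simp [itinerary, ← Function.iterate_add_apply, add_comm]
  linarith

/-- The entropy rate of the stationary process `X, X ∘ T, X ∘ T^2, …`. -/
lemma exists_tendsto_mapEntropy_itinerary [IsProbabilityMeasure μ] {T : Ω → Ω}
    (hT : MeasurePreserving T μ μ) {X : Ω → κ} (hX : FibresNullMeasurable μ X) :
    ∃ h : ℝ, Tendsto (fun n : ℕ => mapEntropy μ (itinerary T X n) / n) atTop (𝓝 h) :=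
  ⟨_, (subadditive_mapEntropy_itinerary hT hX).tendsto_lim ⟨0, by
    rintro _ ⟨n, rfl⟩
    exact div_nonneg (mapEntropy_nonneg _) n.cast_nonneg⟩⟩

/-- Divide `mapEntropy_itinerary_le` by `n`. Replacing `n + N` by `n` costs at most `H(Y^N)` by
subadditivity, which vanishes after division. -/
lemma le_of_tendsto_mapEntropy_itinerary [IsProbabilityMeasure μ] {T : Ω → Ω}
    (hT : MeasurePreserving T μ μ) {X : Ω → κ} (hX : FibresNullMeasurable μ X)
    {Y : Ω → κ'} (hY : FibresNullMeasurable μ Y) (N : ℕ) {a b : ℝ}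
    (ha : Tendsto (fun n : ℕ => mapEntropy μ (itinerary T X n) / n) atTop (𝓝 a))
    (hb : Tendsto (fun n : ℕ => mapEntropy μ (itinerary T Y n) / n) atTop (𝓝 b)) :
    a ≤ b + (mapEntropy μ (fun ω => (X ω, itinerary T Y N ω)) -
      mapEntropy μ (itinerary T Y N)) := by
  set d := mapEntropy μ (fun ω => (X ω, itinerary T Y N ω)) - mapEntropy μ (itinerary T Y N)
  have hc : Tendsto (fun n : ℕ => mapEntropy μ (itinerary T Y N) / (n : ℝ)) atTop (𝓝 0) :=
    tendsto_const_nhds.div_atTop tendsto_natCast_atTop_atTop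
  have h := (hb.add hc).add_const d
  rw [add_zero] at h
  refine le_of_tendsto_of_tendsto ha h ?_
  filter_upwards [eventually_gt_atTop 0] with n hn
  have hn' : (0 : ℝ) < n := by exact_mod_cast hn
  rw [div_le_iff₀ hn', add_mul, add_mul, div_mul_cancel₀ _ hn'.ne', div_mul_cancel₀ _ hn'.ne']
  have h1 := mapEntropy_itinerary_le hT hX hY N n
  have h2 := subadditive_mapEntropy_itinerary hT hY n N
  simp only at h2
  linarith [mul_comm (n : ℝ) d]

end MapEntropy

/-! ## Approximation by finite-valued maps -/

section Approximation

variable {Ω : Type*}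

/-- The sets that are determined by some member of a sequence of maps. -/
def determinedSets {ι : ℕ → Type*} (G : ∀ N, Ω → ι N) : Set (Set Ω) :=
  {A | ∃ N, ∃ B : Set (ι N), A = G N ⁻¹' B}

variable {ι : ℕ → Type*} {G : ∀ N, Ω → ι N}

lemma exists_preimage_of_mem_determinedSets
    (hmono : ∀ N N', N ≤ N' → ∃ φ : ι N' → ι N, G N = φ ∘ G N') {A : Set Ω}
    (hA : A ∈ determinedSets G) : ∃ N, ∀ N' ≥ N, ∃ B : Set (ι N'), A = G N' ⁻¹' B := by
  obtain ⟨N, B, rfl⟩ := hA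
  refine ⟨N, fun N' hN => ?_⟩
  obtain ⟨φ, hφ⟩ := hmono N N' hN
  exact ⟨φ ⁻¹' B, by rw [← preimage_comp, ← hφ]⟩

lemma isSetAlgebra_determinedSets
    (hmono : ∀ N N', N ≤ N' → ∃ φ : ι N' → ι N, G N = φ ∘ G N') :
    IsSetAlgebra (determinedSets G) where
  empty_mem := ⟨0, ∅, by simp⟩
  compl_mem := by
    rintro _ ⟨N, B, rfl⟩
    exact ⟨N, Bᶜ, by simp⟩
  union_mem := by
    intro s t hs ht
    obtain ⟨N, h⟩ := exists_preimage_of_mem_determinedSets hmono hs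
    obtain ⟨N', h'⟩ := exists_preimage_of_mem_determinedSets hmono ht
    obtain ⟨B, rfl⟩ := h (max N N') (le_max_left _ _)
    obtain ⟨B', rfl⟩ := h' (max N N') (le_max_right _ _)
    exact ⟨_, B ∪ B', by simp⟩

variable [MeasurableSpace Ω] {μ : Measure Ω} [IsProbabilityMeasure μ]

lemma tendsto_measureReal_preimage_singleton {κ : Type*} {X : Ω → κ} {Y : ℕ → Ω → κ}
    (h : Tendsto (fun m => μ.real {ω | X ω ≠ Y m ω}) atTop (𝓝 0)) (k : κ) :
    Tendsto (fun m => μ.real (Y m ⁻¹' {k})) atTop (𝓝 (μ.real (X ⁻¹' {k}))) := by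
  rw [tendsto_iff_dist_tendsto_zero]
  refine squeeze_zero (fun _ => dist_nonneg) (fun m => ?_) h
  have h1 : μ.real (X ⁻¹' {k}) ≤ μ.real (Y m ⁻¹' {k}) + μ.real {ω | X ω ≠ Y m ω} := by
    refine (measureReal_mono fun ω hω => ?_).trans (measureReal_union_le _ _)
    by_cases e : X ω = Y m ω
    · exact Or.inl (e.symm.trans hω)
    · exact Or.inr e
  have h2 : μ.real (Y m ⁻¹' {k}) ≤ μ.real (X ⁻¹' {k}) + μ.real {ω | X ω ≠ Y m ω} := by
    refine (measureReal_mono fun ω hω => ?_).trans (measureReal_union_le _ _)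
    by_cases e : X ω = Y m ω
    · exact Or.inl (e.trans hω)
    · exact Or.inr e
  rw [Real.dist_eq, abs_le]
  constructor <;> linarith

/-- Entropy is continuous under convergence in measure. -/
lemma tendsto_mapEntropy {κ : Type*} [Fintype κ] {X : Ω → κ} {Y : ℕ → Ω → κ}
    (h : Tendsto (fun m => μ.real {ω | X ω ≠ Y m ω}) atTop (𝓝 0)) :
    Tendsto (fun m => mapEntropy μ (Y m)) atTop (𝓝 (mapEntropy μ X)) := by
  simp only [mapEntropy_eq_sum_negMulLog]
  exact tendsto_finsetSum _ fun k _ =>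
    (Real.continuous_negMulLog.tendsto _).comp (tendsto_measureReal_preimage_singleton h k)

/-- Approximate every fibre of `X` by a determined set and pass to a common level `N`. Away from the
symmetric differences, the approximating sets are exactly the fibres, so the code `G N` recovers the
value of `X`. -/
lemma exists_factor_measureReal_ne_lt {κ : Type*} [Fintype κ]
    (hmono : ∀ N N', N ≤ N' → ∃ φ : ι N' → ι N, G N = φ ∘ G N')
    (hdense : μ.MeasureDense (determinedSets G)) {X : Ω → κ} (hX : FibresNullMeasurable μ X)
    {δ : ℝ} (hδ : 0 < δ) :
    ∃ N, ∃ φ : ι N → κ, μ.real {ω | X ω ≠ φ (G N ω)} < δ := by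
  classical
  have : Nonempty Ω := nonempty_of_isProbabilityMeasure μ
  have : Nonempty κ := this.map X
  have hc : (0 : ℝ) < Fintype.card κ := by exact_mod_cast Fintype.card_pos
  have happrox : ∀ k, ∃ A ∈ determinedSets G,
      μ (symmDiff (X ⁻¹' {k}) A) < ENNReal.ofReal (δ / Fintype.card κ) := fun k => by
    -- Density approximates measurable sets only, so the fibre is first replaced by its measurable
    -- hull, equal to it almost everywhere.
    obtain ⟨A, hA, h⟩ := hdense.approx (toMeasurable μ (X ⁻¹' {k})) (measurableSet_toMeasurable _ _)
      (measure_ne_top _ _) _ (div_pos hδ hc)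
    refine ⟨A, hA, lt_of_eq_of_lt (measure_congr ?_) h⟩
    exact (hX k).toMeasurable_ae_eq.symm.symmDiff (ae_eq_refl A)
  choose A hA hlt using happrox
  choose n hn using fun k => exists_preimage_of_mem_determinedSets hmono (hA k)
  set N := Finset.univ.sup n
  choose B hB using fun k => hn k N (Finset.le_sup (Finset.mem_univ k))
  -- Codes lying in no `B k` or in several receive an arbitrary admissible value; they occur only
  -- inside the error set.
  refine ⟨N, fun g => if h : ∃ k, g ∈ B k then h.choose else Classical.arbitrary κ, ?_⟩
  have hsub : {ω | X ω ≠ if h : ∃ k, G N ω ∈ B k then h.choose else Classical.arbitrary κ} ⊆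
      ⋃ k ∈ (Finset.univ : Finset κ), symmDiff (X ⁻¹' {k}) (A k) := by
    intro ω hω
    by_contra hcon
    have hiff : ∀ k, X ω = k ↔ G N ω ∈ B k := fun k => by
      have hk : ω ∉ symmDiff (X ⁻¹' {k}) (A k) := fun h => 
        hcon (mem_biUnion (Finset.mem_coe.2 (Finset.mem_univ k)) h)
      rw [hB k, Set.mem_symmDiff] at hk
      simp only [mem_preimage, mem_singleton_iff] at hk
      tauto
    have hex : ∃ k, G N ω ∈ B k := ⟨X ω, (hiff _).1 rfl⟩
    refine hω ?_
    rw [dif_pos hex]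
    exact (hiff _).2 hex.choose_spec
  calc μ.real _ ≤ ∑ k, μ.real (symmDiff (X ⁻¹' {k}) (A k)) :=
        (measureReal_mono hsub (measure_ne_top _ _)).trans (measureReal_biUnion_finset_le _ _)
    _ < ∑ _k : κ, δ / Fintype.card κ := Finset.sum_lt_sum_of_nonempty Finset.univ_nonempty
        fun k _ => (ENNReal.toReal_lt_of_lt_ofReal (hlt k))
    _ = δ := by simp; field_simp

/-- Conditional entropies relative to a generating sequence become arbitrarily small. -/
lemma exists_mapEntropy_prodMk_sub_lt {κ : Type*} [Fintype κ] [∀ N, Fintype (ι N)]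
    (hmono : ∀ N N', N ≤ N' → ∃ φ : ι N' → ι N, G N = φ ∘ G N')
    (hdense : μ.MeasureDense (determinedSets G)) (hG : ∀ N, FibresNullMeasurable μ (G N))
    {X : Ω → κ} (hX : FibresNullMeasurable μ X) {ε : ℝ} (hε : 0 < ε) :
    ∃ N, mapEntropy μ (fun ω => (X ω, G N ω)) - mapEntropy μ (G N) < ε := by
  choose N φ hφ using fun m : ℕ =>
    exists_factor_measureReal_ne_lt hmono hdense hX (δ := 1 / ((m : ℝ) + 1)) (by positivity)
  have h0 : Tendsto (fun m => μ.real {ω | X ω ≠ φ m (G (N m) ω)}) atTop (𝓝 0) :=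
    squeeze_zero (fun _ => measureReal_nonneg) (fun m => (hφ m).le)
      tendsto_one_div_add_atTop_nhds_zero_nat
  have h1 := tendsto_mapEntropy (Y := fun m ω => φ m (G (N m) ω)) h0
  -- The pair `(X, φ m (G (N m)))` converges in measure to `(X, X)`, whose entropy is `H(X)`. Hence
  -- the entropy of `X` conditioned on the approximation tends to `0`; conditioning on the finer `G
  -- (N m)` only lowers it.
  have h2 := tendsto_mapEntropy (μ := μ) (X := fun ω => (X ω, X ω))
    (Y := fun m ω => (X ω, φ m (G (N m) ω))) (by simpa using h0)
  rw [mapEntropy_prodMk_comp X fun k => k] at h2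
  have h3 := h2.sub h1
  rw [sub_self] at h3
  obtain ⟨m, hm⟩ := (h3.eventually_lt_const hε).exists
  exact ⟨N m, (mapEntropy_prodMk_sub_le_of_factor hX (hG _) (φ m)).trans_lt hm⟩

end Approximation

/-! ## Entropy rates of stationary sequences of partitions -/

section EntropyRate

variable {Ω : Type*} [MeasurableSpace Ω] {μ : Measure Ω}

lemma meanEntropy_eq_mapEntropy_itinerary {κ : Type*} [Fintype κ] {T : Ω → Ω} {X : Ω → κ}
    {A : ℕ → κ → Set Ω} (hA : ∀ p k, A p k = {ω | X (T^[p] ω) = k}) (n : ℕ) :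
    meanEntropy μ A n = mapEntropy μ (itinerary T X n) / n := by
  have : iteratedJoin A n = fun w => itinerary T X n ⁻¹' {w} := by
    ext w ω
    simp [iteratedJoin, hA, itinerary, funext_iff]
  rw [meanEntropy, this, mapEntropy]
  ring

lemma exists_entropyRate_eq [IsProbabilityMeasure μ] {κ : Type*} [Fintype κ] {T : Ω → Ω}
    (hT : MeasurePreserving T μ μ) {X : Ω → κ} (hX : FibresNullMeasurable μ X)
    {A : ℕ → κ → Set Ω} (hA : ∀ p k, A p k = {ω | X (T^[p] ω) = k}) :
    ∃ h : ℝ, Tendsto (fun n : ℕ => mapEntropy μ (itinerary T X n) / n) atTop (𝓝 h) ∧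
      entropyRate μ A = h ∧
      Tendsto (fun n : ℕ => ((meanEntropy μ A n : ℝ) : EReal)) atTop (𝓝 (entropyRate μ A)) := by
  obtain ⟨h, hh⟩ := exists_tendsto_mapEntropy_itinerary hT hX
  have hmean : Tendsto (fun n : ℕ => ((meanEntropy μ A n : ℝ) : EReal)) atTop (𝓝 (h : EReal)) := by
    simp only [meanEntropy_eq_mapEntropy_itinerary hA]
    exact (continuous_coe_real_ereal.tendsto h).comp hh
  have he : entropyRate μ A = h := hmean.limsup_eq
  exact ⟨h, hh, he, he ▸ hmean⟩

lemma IsFinitePartition.exists_map {s : ℕ} {P : Fin s → Set Ω} (hP : IsFinitePartition μ P) :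
    ∃ X : Ω → Fin s, ∀ i, P i = X ⁻¹' {i} := by
  have hex : ∀ ω, ∃ i, ω ∈ P i := fun ω => mem_iUnion.1 (hP.cover ▸ mem_univ ω)
  choose X hX using hex
  refine ⟨X, fun i => Subset.antisymm (fun ω hω => ?_) ?_⟩
  · by_contra hne
    exact disjoint_left.1 (hP.disjoint hne) (hX ω) hω
  · rintro ω rfl
    exact hX ω

lemma FibresNullMeasurable.isFinitePartition {s : ℕ} {X : Ω → Fin s}
    (hX : FibresNullMeasurable μ X) : IsFinitePartition μ fun i => X ⁻¹' {i} where
  nullMeasurable := hX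
  disjoint i j hij := (disjoint_singleton.2 hij).preimage X
  cover := by ext ω; simp

/-- The entropy rate of a finite-valued stationary process is a lower bound for the
Kolmogorov–Sinai entropy. -/
lemma le_ksEntropy_of_tendsto [IsProbabilityMeasure μ] {κ : Type*} [Fintype κ] {T : Ω → Ω}
    (hT : MeasurePreserving T μ μ) {X : Ω → κ} (hX : FibresNullMeasurable μ X) {a : ℝ}
    (ha : Tendsto (fun n : ℕ => mapEntropy μ (itinerary T X n) / n) atTop (𝓝 a)) :
    (a : EReal) ≤ ksEntropy μ T := by
  -- The supremum ranges over partitions indexed by `Fin s`, so the values are relabelled.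
  obtain ⟨s, ⟨e⟩⟩ := Finite.exists_equiv_fin κ
  have hY : FibresNullMeasurable μ (e ∘ X) := hX.comp e
  obtain ⟨b, hb, hbe, -⟩ := exists_entropyRate_eq hT hY
    (A := pullbackSeq T fun i => (e ∘ X) ⁻¹' {i}) fun _ _ => rfl
  have hXY : ∀ n, mapEntropy μ (itinerary T (e ∘ X) n) = mapEntropy μ (itinerary T X n) :=
    fun n => mapEntropy_comp_equiv (itinerary T X n) (Equiv.piCongrRight fun _ : Fin n => e)
  simp only [hXY] at hb
  rw [tendsto_nhds_unique ha hb, ← hbe, ksEntropy]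
  exact le_iSup_of_le s <| le_iSup_of_le (fun i => (e ∘ X) ⁻¹' {i}) <|
    le_iSup_of_le hY.isFinitePartition le_rfl

end EntropyRate

/-! ## Path spaces -/

namespace HolomorphicCorrespondence

variable (Γ : HolomorphicCorrespondence)

lemma shift_iterate (p : ℕ) (u : Γ.PathSpace) (r : ℕ) :
    (Γ.shift^[p] u).1.1 r = u.1.1 (r + p) ∧ (Γ.shift^[p] u).1.2 r = u.1.2 (r + p) := by
  induction p generalizing u with
  | zero => exact ⟨rfl, rfl⟩
  | succ p ih =>
    rw [Function.iterate_succ_apply]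
    obtain ⟨h1, h2⟩ := ih (Γ.shift u)
    rw [h1, h2]
    exact ⟨rfl, rfl⟩

lemma measurable_pointProj (r : ℕ) : Measurable (Γ.pointProj r) :=
  (measurable_pi_apply r).comp (measurable_fst.comp measurable_subtype_coe)

lemma measurable_labelProjSucc (r : ℕ) : Measurable (Γ.labelProjSucc r) :=
  (measurable_pi_apply r).comp (measurable_snd.comp measurable_subtype_coe)

/-- The finite-valued map `u ↦ (q(x_0), α_1)`. -/
def codedLabel {κ : Type*} (q : RiemannSphere → κ) (u : Γ.PathSpace) : κ × Fin Γ.M :=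
  (q (Γ.pointProj 0 u), Γ.labelProjSucc 0 u)

variable {Γ}

lemma fibresNullMeasurable_codedLabel {μ : Measure Γ.PathSpace} {κ : Type*}
    {q : RiemannSphere → κ} (hq : FibresNullMeasurable (μ.map (Γ.pointProj 0)) q) :
    FibresNullMeasurable μ (Γ.codedLabel q) := by
  refine FibresNullMeasurable.prodMk (fun k => ?_) fun k => ?_
  -- Null sets of the image measure pull back to `μ`-null sets, so measurability for the completion
  -- survives.
  · exact (hq k).preimage
      ⟨Γ.measurable_pointProj 0, Measure.AbsolutelyContinuous.rfl⟩
  · exact (Γ.measurable_labelProjSucc 0 (measurableSet_singleton k)).nullMeasurableSet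

/-- The point `x_p` and label `α_{p+1}` are the initial point and first label of the `p`-th shift.
This makes the lifted collections a stationary sequence. -/
lemma liftedSeq_eq {s : ℕ} {Q : Fin s → Set RiemannSphere} {q : RiemannSphere → Fin s}
    (hq : ∀ i, Q i = q ⁻¹' {i}) (p : ℕ) (k : Fin s × Fin Γ.M) :
    Γ.liftedSeq Q p k = {u | Γ.codedLabel q (Γ.shift^[p] u) = k} := by
  ext u
  have h1 := (Γ.shift_iterate p u 0).1
  have h2 := (Γ.shift_iterate p u 0).2
  rw [zero_add] at h1 h2
  simp [liftedSeq, codedLabel, pointProj, labelProjSucc, hq, h1, h2, Prod.ext_iff]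

/-! ### Finite codings of points and paths -/

/-- The first `N` sets of a countable generating family, coded as a map with finitely many
values. -/
noncomputable def sphereCode (N : ℕ) (x : RiemannSphere) : Fin (Fintype.card (Fin N → Prop)) :=
  Fintype.equivFin (Fin N → Prop)
    fun i => x ∈ MeasurableSpace.natGeneratingSequence RiemannSphere i

lemma measurable_sphereCode (N : ℕ) : Measurable (sphereCode N) :=
  (measurable_of_countable (Fintype.equivFin (Fin N → Prop))).comp <|
    measurable_pi_iff.2 fun i =>
      measurable_mem.2 (MeasurableSpace.measurableSet_natGeneratingSequence (i : ℕ))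

lemma fibresNullMeasurable_sphereCode (ν : Measure RiemannSphere) (N : ℕ) :
    FibresNullMeasurable ν (sphereCode N) := fun k =>
  (measurable_sphereCode N (measurableSet_singleton k)).nullMeasurableSet

/-- The first `N` steps of a path, with points coded by `sphereCode N`. -/
noncomputable def pathCode (N : ℕ) :
    Γ.PathSpace → Fin N → Fin (Fintype.card (Fin N → Prop)) × Fin Γ.M :=
  itinerary Γ.shift (Γ.codedLabel (sphereCode N)) N

lemma pathCode_apply (N : ℕ) (u : Γ.PathSpace) (p : Fin N) :
    pathCode N u p = (sphereCode N (u.1.1 p), u.1.2 p) := by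
  have h1 := (Γ.shift_iterate p u 0).1
  have h2 := (Γ.shift_iterate p u 0).2
  rw [zero_add] at h1 h2
  simp [pathCode, itinerary, codedLabel, pointProj, labelProjSucc, h1, h2]

/-- The finer code sees more steps and more generating sets; truncating both gives the coarser one.
-/
lemma pathCode_factor (N N' : ℕ) (h : N ≤ N') :
    ∃ φ, (pathCode N : Γ.PathSpace → _) = φ ∘ pathCode N' := by
  refine ⟨fun w p => (Fintype.equivFin (Fin N → Prop) fun i =>
    (Fintype.equivFin (Fin N' → Prop)).symm (w (Fin.castLE h p)).1 (Fin.castLE h i),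
    (w (Fin.castLE h p)).2), ?_⟩
  ext1 u
  ext1 p
  simp [pathCode_apply, sphereCode]

lemma measurable_pathCode (N : ℕ) : Measurable (pathCode N : Γ.PathSpace → _) :=
  measurable_pi_iff.2 fun p => by
    simp only [pathCode_apply]
    exact ((measurable_sphereCode N).comp (Γ.measurable_pointProj p)).prodMk
      (Γ.measurable_labelProjSucc p)

/-- The sigma-algebra comes from the coordinates, so it suffices to read each of them off some code.
-/
lemma generateFrom_determinedSets_pathCode :
    (inferInstance : MeasurableSpace Γ.PathSpace) =
      MeasurableSpace.generateFrom (determinedSets (pathCode (Γ := Γ))) := by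
  refine le_antisymm ?_ (MeasurableSpace.generateFrom_le ?_)
  · set m := MeasurableSpace.generateFrom (determinedSets (pathCode (Γ := Γ))) with hm
    have hpoint : ∀ r, @Measurable _ _ m _ (Γ.pointProj r) := fun r => by
      have h := @measurable_generateFrom _ _ m
        (range (MeasurableSpace.natGeneratingSequence RiemannSphere)) (Γ.pointProj r) (by
          rintro _ ⟨i, rfl⟩
          -- The level must exceed both `r`, to see the point `x_r`, and `i`, to test the `i`-th
          -- generating set.
          refine MeasurableSpace.measurableSet_generateFrom ⟨max r i + 1, {w |
            (Fintype.equivFin (Fin (max r i + 1) → Prop)).symm (w ⟨r, by omega⟩).1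
              ⟨i, by omega⟩}, ?_⟩
          ext u
          simp [pathCode_apply, sphereCode, pointProj])
      rwa [MeasurableSpace.generateFrom_natGeneratingSequence] at h
    have hlabel : ∀ r, @Measurable _ _ m _ (Γ.labelProjSucc r) := fun r => by
      refine @measurable_to_countable' _ _ _ _ m _ fun t =>
        MeasurableSpace.measurableSet_generateFrom
          ⟨r + 1, {w | (w ⟨r, by omega⟩).2 = t}, ?_⟩
      ext u
      simp [pathCode_apply, labelProjSucc]
    have hval : @Measurable _ _ m _ (Subtype.val : Γ.PathSpace → _) :=
      Measurable.prodMk (@measurable_pi_lambda _ _ _ m _ _ hpoint)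
        (@measurable_pi_lambda _ _ _ m _ _ hlabel)
    exact hval.comap_le
  · rintro _ ⟨N, B, rfl⟩
    exact measurable_pathCode N (Set.toFinite B).measurableSet

lemma measureDense_determinedSets_pathCode (μ : Measure Γ.PathSpace) [IsProbabilityMeasure μ] :
    μ.MeasureDense (determinedSets (pathCode (Γ := Γ))) :=
  Measure.MeasureDense.of_generateFrom_isSetAlgebra_finite μ
    (isSetAlgebra_determinedSets pathCode_factor) generateFrom_determinedSets_pathCode

/-! ### The two inequalities -/

lemma entropyRate_liftedSeq_le_ksEntropy {μ : Measure Γ.PathSpace} [IsProbabilityMeasure μ]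
    (hμ : MeasurePreserving Γ.shift μ μ) {s : ℕ} {Q : Fin s → Set RiemannSphere}
    (hQ : IsFinitePartition (μ.map (Γ.pointProj 0)) Q) :
    entropyRate μ (Γ.liftedSeq Q) ≤ ksEntropy μ Γ.shift := by
  obtain ⟨q, hq⟩ := hQ.exists_map
  have hX : FibresNullMeasurable μ (Γ.codedLabel q) :=
    fibresNullMeasurable_codedLabel fun k => hq k ▸ hQ.nullMeasurable k
  obtain ⟨a, ha, hae, -⟩ := exists_entropyRate_eq hμ hX (liftedSeq_eq hq)
  exact hae ▸ le_ksEntropy_of_tendsto hμ hX ha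

lemma entropyRate_pullbackSeq_le_intermediateEntropy {μ : Measure Γ.PathSpace}
    [IsProbabilityMeasure μ] (hμ : MeasurePreserving Γ.shift μ μ) {s : ℕ}
    {P : Fin s → Set Γ.PathSpace} (hP : IsFinitePartition μ P) :
    entropyRate μ (pullbackSeq Γ.shift P) ≤
      Γ.intermediateEntropy (μ.map (Γ.pointProj 0)) μ := by
  obtain ⟨X, hXP⟩ := hP.exists_map
  have hX : FibresNullMeasurable μ X := fun k => hXP k ▸ hP.nullMeasurable k
  obtain ⟨a, ha, hae, -⟩ := exists_entropyRate_eq hμ hX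
    (A := pullbackSeq Γ.shift P) fun p k => by rw [pullbackSeq, hXP]; rfl
  -- The intermediate entropy may be infinite, so the comparison is with real `z` strictly above it.
  rw [hae, ← EReal.le_of_forall_lt_iff_le]
  intro z hz
  refine EReal.coe_le_coe_iff.2 (le_of_forall_pos_le_add fun ε hε => ?_)
  obtain ⟨N, hN⟩ := exists_mapEntropy_prodMk_sub_lt pathCode_factor
    (measureDense_determinedSets_pathCode μ)
    (fun N w => (measurable_pathCode N (measurableSet_singleton w)).nullMeasurableSet) hX hε
  have hν := fibresNullMeasurable_sphereCode (μ.map (Γ.pointProj 0)) N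
  have hY := fibresNullMeasurable_codedLabel hν
  obtain ⟨b, hb, hbe, -⟩ := exists_entropyRate_eq hμ hY
    (liftedSeq_eq (Q := fun i => sphereCode N ⁻¹' {i}) fun _ => rfl)
  -- The same `N` serves as the fineness of the sphere partition and as the length of the
  -- conditioning itinerary, which is `pathCode N`.
  have hab := le_of_tendsto_mapEntropy_itinerary hμ hX hY N ha hb
  have hbz : (b : EReal) < z := by
    refine lt_of_le_of_lt ?_ hz
    rw [← hbe]
    exact le_iSup_of_le _ (le_iSup_of_le _ (le_iSup_of_le hν.isFinitePartition le_rfl))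
  have hbz' := EReal.coe_lt_coe_iff.1 hbz
  rw [pathCode] at hN
  linarith

end HolomorphicCorrespondence

theorem mainTheorem1 (Γ : HolomorphicCorrespondence)
    (μ : Measure Γ.PathSpace) [IsProbabilityMeasure μ]
    (hμ : MeasurePreserving Γ.shift μ μ)
    (ν : Measure RiemannSphere) (hν : ν = μ.map (Γ.pointProj 0)) :
    (∀ (s : ℕ) (Q : Fin s → Set RiemannSphere), IsFinitePartition ν Q →
      Tendsto (fun n : ℕ => ((meanEntropy μ (Γ.liftedSeq Q) n : ℝ) : EReal)) atTop
        (𝓝 (entropyRate μ (Γ.liftedSeq Q)))) ∧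
    (∀ (s : ℕ) (P : Fin s → Set Γ.PathSpace), IsFinitePartition μ P →
      Tendsto (fun n : ℕ => ((meanEntropy μ (pullbackSeq Γ.shift P) n : ℝ) : EReal)) atTop
        (𝓝 (entropyRate μ (pullbackSeq Γ.shift P)))) ∧
    Γ.intermediateEntropy ν μ = ksEntropy μ Γ.shift := by
  subst hν
  refine ⟨fun s Q hQ => ?_, fun s P hP => ?_, le_antisymm ?_ ?_⟩
  · obtain ⟨q, hq⟩ := hQ.exists_map
    obtain ⟨_, -, -, h⟩ := exists_entropyRate_eq hμ
      (HolomorphicCorrespondence.fibresNullMeasurable_codedLabel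
        fun k => hq k ▸ hQ.nullMeasurable k)
      (HolomorphicCorrespondence.liftedSeq_eq hq)
    exact h
  · obtain ⟨X, hX⟩ := hP.exists_map
    obtain ⟨_, -, -, h⟩ := exists_entropyRate_eq hμ (X := X) (fun k => hX k ▸ hP.nullMeasurable k)
      (A := pullbackSeq Γ.shift P) fun p k => by rw [pullbackSeq, hX]; rfl
    exact h
  · exact iSup_le fun s => iSup_le fun Q => iSup_le fun hQ =>
      HolomorphicCorrespondence.entropyRate_liftedSeq_le_ksEntropy hμ hQ
  · exact iSup_le fun s => iSup_le fun P => iSup_le fun hP =>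
      HolomorphicCorrespondence.entropyRate_pullbackSeq_le_intermediateEntropy hμ hP
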